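/- Let $k\ge 0$ and $n\ge 1$, let $F(k)$ be the free group on $k$ generators $x_1,\dots,x_k$ with identity $e$, and let $t_1,\dots,t_n$ be group terms in the variables $x_1,\dots,x_k$, each of which also denotes the element of $F(k)$ that it represents. For a subset $S$ of a group, write $\langle S\rangle$ for the subsemigroup generated by $S$. A right order of a group $G$ is a total order $\le$ on $G$ such that $a\le b$ implies $ac\le bc$ for all $a,b,c\in G$; a subset $S\subseteq G$ extends to a right order of $G$ if there is a right order $\le$ of $G$ with $e<a$ for all $a\in S$. A lattice-ordered group ($\ell$-group) is a group $L$ with a lattice order such that $a\le b$ implies $cad\le cbd$ for all $a,b,c,d\in L$. Then the following are equivalent: (1) The inequality $e\le t_1\vee\dots\vee t_n$ is valid in all $\ell$-groups, i.e. it holds in every $\ell$-group under every assignment of elements to the variables $x_1,\dots,x_k$. (2) $\{t_1,\dots,t_n\}$ does not extend to a right order of $F(k)$. (3) There exist $m\ge 0$ and $s_1,\dots,s_m\in F(k)\setminus\{e\}$ such that $e\in\langle\{t_1,\dots,t_n,s_1^{\delta_1},\dots,s_m^{\delta_m}\}\rangle$ for all $\delta_1,\dots,\delta_m\in\{-1,1\}$.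 -/

import Mathlib

universe u

/-- Group terms over the variables `x_0, …, x_{k-1}`. -/
inductive GroupTerm (k : ℕ) : Type
  | var : Fin k → GroupTerm k
  | one : GroupTerm k
  | mul : GroupTerm k → GroupTerm k → GroupTerm k
  | inv : GroupTerm k → GroupTerm k

/-- The value of a group term in a group under an assignment of the variables. -/
def GroupTerm.eval {k : ℕ} {G : Type*} [Group G] (v : Fin k → G) : GroupTerm k → G
  | .var i => v i
  | .one => 1
  | .mul s t => s.eval v * t.eval v
  | .inv t => (t.eval v)⁻¹

/-- The element of the free group `F(k)` that a group term represents. -/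
def GroupTerm.toFree {k : ℕ} (t : GroupTerm k) : FreeGroup (Fin k) :=
  t.eval FreeGroup.of

/-- The inequality `e ≤ t_1 ∨ … ∨ t_n` (with `n ≥ 1`) is valid in all lattice-ordered groups
(with carrier in the universe `u`), i.e. it holds under every assignment of the variables.
A lattice-ordered group is a group and a lattice in which all left and right translations
are monotone. -/
def ValidInLGroups {k n : ℕ} [NeZero n] (t : Fin n → GroupTerm k) : Prop :=
  ∀ (L : Type u) [Group L] [Lattice L] [MulLeftMono L] [MulRightMono L] (v : Fin k → L),
    1 ≤ Finset.univ.sup' Finset.univ_nonempty (fun i => (t i).eval v)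

/-- `le` is a partial right order of the group `G`. -/
structure IsPartialRightOrder {G : Type*} [Group G] (le : G → G → Prop) : Prop where
  refl : ∀ a, le a a
  trans : ∀ a b c, le a b → le b c → le a c
  antisymm : ∀ a b, le a b → le b a → a = b
  mul_right : ∀ a b c, le a b → le (a * c) (b * c)

/-- The (strict) positive cone `{a | e < a}` of a relation `le`. -/
def positiveCone {G : Type*} [Group G] (le : G → G → Prop) : Set G :=
  {a | le 1 a ∧ a ≠ 1}

/-- A (total) right order: a partial right order with `G = P ∪ P⁻¹ ∪ {e}`. -/
structure IsRightOrder {G : Type*} [Group G] (le : G → G → Prop) : Prop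
    extends IsPartialRightOrder le where
  total : ∀ a, a ∈ positiveCone le ∨ a⁻¹ ∈ positiveCone le ∨ a = 1

/-- The subset `S` extends to a right order of `G`: it lies in the positive cone of one. -/
def ExtendsToRightOrder {G : Type*} [Group G] (S : Set G) : Prop :=
  ∃ le : G → G → Prop, IsRightOrder le ∧ S ⊆ positiveCone le

/-!
A right order is the same thing as a subsemigroup `P ∌ 1` meeting every pair `{a, a⁻¹}`, `a ≠ 1`.
Such a `P` containing `S` exists as soon as, for each finite set of non-identity elements, there is
one that meets the corresponding finitely many pairs: take a limit along an ultrafilter. This gives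
(2) ⇔ (3).

A right order `≤` of a group `G` lets `G` act on the chain `(G, ≤)` by automorphisms, which form an
`ℓ`-group; evaluating the inequality there at the point `1` gives (1) ⇒ (2).

Conversely, suppose that the join `b` of the values of the `tᵢ` in an `ℓ`-group `L` is not `≥ 1`.
A maximal set `U` of elements `> 1` that is closed under meets and contains `b⁻¹ ⊔ 1` yields a total
right preorder on `L` whose nonpositive elements are the `a` with `a⁺ ⊓ u = 1` for some `u ∈ U`, and
in which `b` and all values of the `tᵢ` are strictly negative. Pull it back to `F(k)`, break ties
with a right order of `F(k)` and reverse the result. Right orders of `F(k)` exist by the Burns–Hale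
argument, because each nontrivial subgroup, being free, has a nontrivial homomorphism to `ℤ`.
-/

section RightOrder

variable {G : Type*} [Group G]

/-- The strict positive cones of right orders: subsemigroups that omit `1` and contain `a` or `a⁻¹`
for each `a ≠ 1`. -/
structure IsRightOrderCone (P : Subsemigroup G) : Prop where
  one_notMem : 1 ∉ P
  mem_or_inv_mem : ∀ a, a ≠ 1 → a ∈ P ∨ a⁻¹ ∈ P

/-- The relation `a ≤ b` whose strict positive cone is `P`. -/
def coneLE (P : Subsemigroup G) (a b : G) : Prop :=
  a = b ∨ b * a⁻¹ ∈ P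

theorem positiveCone_coneLE {P : Subsemigroup G} (h1 : 1 ∉ P) : positiveCone (coneLE P) = P := by
  ext a
  have hne : a ∈ P → a ≠ 1 := fun ha h => h1 (h ▸ ha)
  simp only [positiveCone, coneLE, Set.mem_ofPred_eq, inv_one, mul_one, SetLike.mem_coe]
  exact ⟨fun h => h.1.resolve_left h.2.symm, fun h => ⟨Or.inr h, hne h⟩⟩

theorem IsRightOrderCone.isRightOrder_coneLE {P : Subsemigroup G} (hP : IsRightOrderCone P) :
    IsRightOrder (coneLE P) where
  refl _ := Or.inl rfl
  trans := by
    rintro a b c (rfl | hab) (rfl | hbc)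
    · exact Or.inl rfl
    · exact Or.inr hbc
    · exact Or.inr hab
    · exact Or.inr (by simpa [mul_assoc] using mul_mem hbc hab)
  antisymm := by
    rintro a b (rfl | hab) (hba | hba)
    · rfl
    · rfl
    · exact hba.symm
    · exact absurd (by simpa [mul_assoc] using mul_mem hba hab) hP.one_notMem
  mul_right := by
    rintro a b c (rfl | hab)
    · exact Or.inl rfl
    · exact Or.inr (by simpa [mul_assoc] using hab)
  total a := by
    rw [positiveCone_coneLE hP.one_notMem, ← or_assoc]
    exact or_iff_not_imp_right.2 (hP.mem_or_inv_mem a)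

namespace IsRightOrder

variable {le : G → G → Prop}

/-- The strict positive cone of a right order, as a subsemigroup. -/
def cone (h : IsRightOrder le) : Subsemigroup G where
  carrier := positiveCone le
  mul_mem' {a b} ha hb := by
    have hab : le b (a * b) := by simpa using h.mul_right 1 a b ha.1
    refine ⟨h.trans _ _ _ hb.1 hab, fun h1 => hb.2 ?_⟩
    exact h.antisymm _ _ (h1 ▸ hab) hb.1

theorem isRightOrderCone_cone (h : IsRightOrder le) : IsRightOrderCone h.cone where
  one_notMem h1 := h1.2 rfl
  mem_or_inv_mem a ha := (or_assoc.2 (h.total a)).resolve_right ha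

/-- The linear order given by a right order. -/
noncomputable abbrev linearOrder (h : IsRightOrder le) : LinearOrder G where
  le := le
  le_refl := h.refl
  le_trans := h.trans
  le_antisymm := h.antisymm
  le_total a b := by
    rcases h.total (b * a⁻¹) with hab | hab | hab
    · exact Or.inl (by simpa using h.mul_right _ _ a hab.1)
    · exact Or.inr (by simpa using h.mul_right _ _ b hab.1)
    · exact Or.inl (mul_inv_eq_one.1 hab ▸ h.refl _)
  toDecidableLE := Classical.decRel _

end IsRightOrder

theorem extendsToRightOrder_iff_exists_cone {S : Set G} :
    ExtendsToRightOrder S ↔ ∃ P : Subsemigroup G, IsRightOrderCone P ∧ S ⊆ P := by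
  constructor
  · rintro ⟨le, hle, hS⟩
    exact ⟨hle.cone, hle.isRightOrderCone_cone, hS⟩
  · rintro ⟨P, hP, hS⟩
    exact ⟨coneLE P, hP.isRightOrder_coneLE, hS.trans_eq (positiveCone_coneLE hP.one_notMem).symm⟩

/-- The elements that lie eventually in the subsemigroups `P i`. -/
def eventualSubsemigroup {M ι : Type*} [Mul M] (l : Filter ι) (P : ι → Subsemigroup M) :
    Subsemigroup M where
  carrier := {a | ∀ᶠ i in l, a ∈ P i}
  mul_mem' ha hb := by
    filter_upwards [ha, hb] with i hai hbi using mul_mem hai hbi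

theorem extendsToRightOrder_of_forall_finset {S : Set G}
    (h : ∀ A : Finset G, 1 ∉ A →
      ∃ P : Subsemigroup G, S ⊆ P ∧ 1 ∉ P ∧ ∀ a ∈ A, a ∈ P ∨ a⁻¹ ∈ P) :
    ExtendsToRightOrder S := by
  classical
  choose P hSP h1P hP using fun A : Finset G => h (A.erase 1) (A.notMem_erase 1)
  let 𝓤 : Ultrafilter (Finset G) := Ultrafilter.of Filter.atTop
  refine extendsToRightOrder_iff_exists_cone.2
    ⟨eventualSubsemigroup 𝓤 P, ⟨fun h1 => ?_, fun a ha => ?_⟩,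
      fun a ha => Filter.Eventually.of_forall fun A => hSP A ha⟩
  · obtain ⟨A, hA⟩ := h1.exists
    exact h1P A hA
  · have hmem : ∀ᶠ A in (𝓤 : Filter (Finset G)), a ∈ A := Ultrafilter.of_le Filter.atTop <|
      (Filter.eventually_ge_atTop {a}).mono fun A hA => Finset.singleton_subset_iff.1 hA
    exact Ultrafilter.eventually_or.1 <|
      hmem.mono fun A hA => hP A a (Finset.mem_erase.2 ⟨ha, hA⟩)

theorem exists_zpow_units_mem_iff {S : Set G} {a : G} :
    (∃ δ : ℤˣ, a ^ (δ : ℤ) ∈ S) ↔ a ∈ S ∨ a⁻¹ ∈ S := by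
  constructor
  · rintro ⟨δ, hδ⟩
    rcases Int.units_eq_one_or δ with rfl | rfl
    · exact Or.inl (by simpa using hδ)
    · exact Or.inr (by simpa using hδ)
  · rintro (ha | ha)
    · exact ⟨1, by simpa using ha⟩
    · exact ⟨-1, by simpa using ha⟩

theorem not_extendsToRightOrder_iff_forall_signs {S : Set G} :
    ¬ ExtendsToRightOrder S ↔
      ∃ (m : ℕ) (s : Fin m → G), (∀ j, s j ≠ 1) ∧ ∀ δ : Fin m → ℤˣ,
        (1 : G) ∈ Subsemigroup.closure (S ∪ Set.range fun j => s j ^ (δ j : ℤ)) := by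
  constructor
  · contrapose!
    intro hS
    refine extendsToRightOrder_of_forall_finset fun A hA => ?_
    obtain ⟨δ, hδ⟩ := hS A.card (fun j => A.equivFin.symm j)
      (fun j hj => hA (hj ▸ (A.equivFin.symm j).2))
    obtain ⟨hS', hA'⟩ := Set.union_subset_iff.1 (Subsemigroup.subset_closure (M := G))
    refine ⟨_, hS', hδ, fun a ha => exists_zpow_units_mem_iff.1 ⟨δ (A.equivFin ⟨a, ha⟩), ?_⟩⟩
    exact hA' ⟨A.equivFin ⟨a, ha⟩, by simp only [Equiv.symm_apply_apply]⟩
  · rintro ⟨m, s, hs, h⟩ hS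
    obtain ⟨P, hP, hSP⟩ := extendsToRightOrder_iff_exists_cone.1 hS
    choose δ hδ using fun j => exists_zpow_units_mem_iff.2 (hP.mem_or_inv_mem (s j) (hs j))
    have hle := Subsemigroup.closure_le.2 (Set.union_subset hSP (Set.range_subset_iff.2 hδ))
    exact hP.one_notMem (hle (h δ))

end RightOrder

section Lexicographic

variable {G : Type*} [Group G]

/-- The strict positive cone of the lexicographic order in which the preorder with nonnegative cone
`Q` is refined by the order with strict positive cone `P`. -/
def lexSubsemigroup (Q : Submonoid G) (P : Subsemigroup G) : Subsemigroup G where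
  carrier := {g | g ∈ Q ∧ (g⁻¹ ∈ Q → g ∈ P)}
  mul_mem' := by
    rintro a b ⟨ha, ha'⟩ ⟨hb, hb'⟩
    refine ⟨mul_mem ha hb, fun hab => mul_mem (ha' ?_) (hb' ?_)⟩
    · simpa using mul_mem hb hab
    · simpa using mul_mem hab ha

variable {Q : Submonoid G} {P : Subsemigroup G} {a : G}

theorem one_notMem_lexSubsemigroup (h : 1 ∉ P) : 1 ∉ lexSubsemigroup Q P :=
  fun h1 => h (h1.2 (by simp))

variable [HasMemOrInvMem Q]

theorem mem_lexSubsemigroup_of_inv_notMem (h : a⁻¹ ∉ Q) : a ∈ lexSubsemigroup Q P :=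
  ⟨(mem_or_inv_mem Q a).resolve_right h, fun ha => absurd ha h⟩

theorem mem_or_inv_mem_lexSubsemigroup (h : a ∈ Q.mulSupport → a ∈ P ∨ a⁻¹ ∈ P) :
    a ∈ lexSubsemigroup Q P ∨ a⁻¹ ∈ lexSubsemigroup Q P := by
  by_cases ha : a ∈ Q
  · by_cases ha' : a⁻¹ ∈ Q
    · exact (h ⟨ha, ha'⟩).imp (fun hP => ⟨ha, fun _ => hP⟩) (fun hP => ⟨ha', fun _ => hP⟩)
    · exact Or.inl (mem_lexSubsemigroup_of_inv_notMem ha')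
  · exact Or.inr (mem_lexSubsemigroup_of_inv_notMem (by rwa [inv_inv]))

theorem isRightOrderCone_lexSubsemigroup (hP : IsRightOrderCone P) :
    IsRightOrderCone (lexSubsemigroup Q P) where
  one_notMem := one_notMem_lexSubsemigroup hP.one_notMem
  mem_or_inv_mem a ha := mem_or_inv_mem_lexSubsemigroup fun _ => hP.mem_or_inv_mem a ha

end Lexicographic

section BurnsHale

variable {G : Type*} [Group G]

instance {H : Type*} [Group H] (φ : G →* H) (Q : Submonoid H) [HasMemOrInvMem Q] :
    HasMemOrInvMem (Q.comap φ) where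
  mem_or_inv_mem a := by simpa using mem_or_inv_mem Q (φ a)

theorem exists_notMem_mulSupport_of_ne_top {A : Set G} {Q : Submonoid (Subgroup.closure A)}
    (hQ : Q ≠ ⊤) : ∃ a, ∃ ha : a ∈ A, ⟨a, Subgroup.subset_closure ha⟩ ∉ Q.mulSupport := by
  by_contra! h
  have htop : Q.mulSupport = ⊤ := by
    rw [eq_top_iff, ← Subgroup.closure_closure_coe_preimage, Subgroup.closure_le]
    exact fun a ha => h a ha
  exact hQ (eq_top_iff.2 fun a _ => (htop.ge (Subgroup.mem_top a)).1)

theorem exists_subsemigroup_of_forall_subgroup_fg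
    (h : ∀ K : Subgroup G, K.FG → K ≠ ⊥ → ∃ Q : Submonoid K, HasMemOrInvMem Q ∧ Q ≠ ⊤)
    (A : Finset G) (hA : 1 ∉ A) :
    ∃ P : Subsemigroup G, 1 ∉ P ∧ ∀ a ∈ A, a ∈ P ∨ a⁻¹ ∈ P := by
  classical
  induction A using Finset.strongInduction with
  | H A ih =>
    rcases A.eq_empty_or_nonempty with rfl | ⟨a₀, ha₀⟩
    · exact ⟨⊥, Subsemigroup.notMem_bot, by simp⟩
    let K := Subgroup.closure (A : Set G)
    let ι : K →ₙ* G := K.subtype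
    have hK : ∀ {a}, a ∈ A → a ∈ K := fun ha => Subgroup.subset_closure ha
    have hbot : K ≠ ⊥ := fun hK' => hA (Subgroup.mem_bot.1 (hK' ▸ hK ha₀) ▸ ha₀)
    obtain ⟨Q, _, hQ⟩ := h K ⟨A, rfl⟩ hbot
    obtain ⟨a, ha, haQ⟩ := exists_notMem_mulSupport_of_ne_top hQ
    let A₀ := A.filter fun x => ∃ hx : x ∈ K, ⟨x, hx⟩ ∈ Q.mulSupport
    have hssub : A₀ ⊂ A := Finset.filter_ssubset.2 ⟨a, ha, fun ⟨_, hx⟩ => haQ hx⟩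
    obtain ⟨P, h1P, hP⟩ := ih A₀ hssub fun h1 => hA (Finset.mem_of_mem_filter _ h1)
    refine ⟨(lexSubsemigroup Q (P.comap ι)).map ι, ?_, fun x hx => ?_⟩
    · rintro ⟨y, hy, hy1⟩
      obtain rfl : y = 1 := Subtype.ext hy1
      exact one_notMem_lexSubsemigroup (by simpa using h1P) hy
    · have hxP := mem_or_inv_mem_lexSubsemigroup (Q := Q) (P := P.comap ι)
        (a := ⟨x, hK hx⟩) fun hxQ => hP x (Finset.mem_filter.2 ⟨hx, hK hx, hxQ⟩)
      exact hxP.imp (fun h => ⟨_, h, rfl⟩) (fun h => ⟨_, h, rfl⟩)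

theorem extendsToRightOrder_empty_of_forall_subgroup_fg
    (h : ∀ K : Subgroup G, K.FG → K ≠ ⊥ → ∃ Q : Submonoid K, HasMemOrInvMem Q ∧ Q ≠ ⊤) :
    ExtendsToRightOrder (∅ : Set G) :=
  extendsToRightOrder_of_forall_finset fun A hA =>
    (exists_subsemigroup_of_forall_subgroup_fg h A hA).imp fun _ => And.intro (Set.empty_subset _)

theorem exists_hasMemOrInvMem_ne_top_of_isFreeGroup [IsFreeGroup G] [Nontrivial G] :
    ∃ Q : Submonoid G, HasMemOrInvMem Q ∧ Q ≠ ⊤ := by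
  obtain ⟨i⟩ : Nonempty (IsFreeGroup.Generators G) := by
    by_contra! hempty
    exact not_subsingleton G (IsFreeGroup.toFreeGroup G).toEquiv.subsingleton
  let φ : G →* Multiplicative ℤ := IsFreeGroup.lift fun _ => Multiplicative.ofAdd 1
  let Q : Submonoid (Multiplicative ℤ) := Submonoid.oneLE _
  have : HasMemOrInvMem Q := ⟨fun a => by simpa [Q] using le_total 1 a⟩
  refine ⟨Q.comap φ, inferInstance, fun htop => ?_⟩
  have hmem : (IsFreeGroup.of i)⁻¹ ∈ Q.comap φ := htop ▸ Submonoid.mem_top _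
  have hle : (1 : Multiplicative ℤ) ≤ (Multiplicative.ofAdd 1)⁻¹ := by
    simpa [Q, φ] using hmem
  exact absurd hle (by decide)

theorem extendsToRightOrder_empty_of_isFreeGroup [IsFreeGroup G] :
    ExtendsToRightOrder (∅ : Set G) :=
  extendsToRightOrder_empty_of_forall_subgroup_fg fun K _ hK =>
    have : Nontrivial K := K.nontrivial_iff_ne_bot.2 hK
    exists_hasMemOrInvMem_ne_top_of_isFreeGroup

end BurnsHale

section MaximalInfClosed

variable {α : Type*} [SemilatticeInf α] {s : Set α}

theorem infClosed_sUnion_of_directedOn {C : Set (Set α)} (hdir : DirectedOn (· ⊆ ·) C)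
    (hC : ∀ V ∈ C, InfClosed V) : InfClosed (⋃₀ C) := by
  rintro a ⟨V, hV, ha⟩ b ⟨W, hW, hb⟩
  obtain ⟨X, hX, hVX, hWX⟩ := hdir V hV W hW
  exact ⟨X, hX, hC X hX (hVX ha) (hWX hb)⟩

theorem exists_maximal_infClosed_subset {c : α} (hc : c ∈ s) :
    ∃ U : Set α, c ∈ U ∧ Maximal (fun U => InfClosed U ∧ U ⊆ s) U := by
  obtain ⟨U, hcU, hU⟩ := zorn_subset_nonempty {U : Set α | InfClosed U ∧ U ⊆ s}
    (fun C hC hchain _ => ⟨⋃₀ C, ⟨infClosed_sUnion_of_directedOn hchain.directedOn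
      fun V hV => (hC hV).1, Set.sUnion_subset fun V hV => (hC hV).2⟩,
      fun V hV => Set.subset_sUnion_of_mem hV⟩)
    {c} ⟨infClosed_singleton, Set.singleton_subset_iff.2 hc⟩
  exact ⟨U, hcU rfl, hU⟩

theorem inf_mem_of_maximal_infClosed {U : Set α}
    (hU : Maximal (fun U => InfClosed U ∧ U ⊆ s) U) {a : α} (ha : ∀ u ∈ U, a ⊓ u ∈ s) :
    ∀ u ∈ U, a ⊓ u ∈ U := by
  have hclosed : InfClosed (U ∪ (a ⊓ ·) '' U) := by
    rintro _ (hu | ⟨u, hu, rfl⟩) _ (hv | ⟨v, hv, rfl⟩)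
    · exact Or.inl (hU.prop.1 hu hv)
    · exact Or.inr ⟨_, hU.prop.1 hu hv, inf_left_comm _ _ _⟩
    · exact Or.inr ⟨_, hU.prop.1 hu hv, (inf_assoc _ _ _).symm⟩
    · exact Or.inr ⟨_, hU.prop.1 hu hv, inf_inf_distrib_left _ _ _⟩
  have hsub : U ∪ (a ⊓ ·) '' U ⊆ s := Set.union_subset hU.prop.2 (Set.image_subset_iff.2 ha)
  exact fun u hu => hU.le_of_ge ⟨hclosed, hsub⟩ Set.subset_union_left (Or.inr ⟨u, hu, rfl⟩)

end MaximalInfClosed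

section LatticeOrderedGroup

variable {L : Type*} [Group L] [Lattice L] [MulLeftMono L] [MulRightMono L]

theorem inf_mul_le_inf_mul_inf {a b c : L} (ha : 1 ≤ a) (hb : 1 ≤ b) (hc : 1 ≤ c) :
    a ⊓ b * c ≤ (a ⊓ b) * (a ⊓ c) := by
  rw [inf_mul, mul_inf, mul_inf]
  refine le_inf (le_inf ?_ ?_) (le_inf ?_ inf_le_right)
  · exact inf_le_left.trans (le_mul_of_one_le_left' ha)
  · exact inf_le_left.trans (le_mul_of_one_le_right' hc)
  · exact inf_le_left.trans (le_mul_of_one_le_left' hb)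

theorem oneLePart_mul_le (a b : L) : (a * b)⁺ᵐ ≤ a⁺ᵐ * b⁺ᵐ :=
  sup_le (mul_le_mul' (le_oneLePart a) (le_oneLePart b))
    (one_le_mul (one_le_oneLePart a) (one_le_oneLePart b))

/-- The elements whose positive part is orthogonal to an element of `U`. For maximal `U` this is the
nonpositive cone of a total right preorder. -/
def polarSubmonoid (U : Set L) (hU : InfClosed U) (hne : U.Nonempty) (h1 : ∀ u ∈ U, 1 ≤ u) :
    Submonoid L where
  carrier := {a | ∃ u ∈ U, u ⊓ a⁺ᵐ = 1}
  one_mem' := hne.imp fun u hu => ⟨hu, by simpa using h1 u hu⟩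
  mul_mem' := by
    rintro a b ⟨u, hu, hau⟩ ⟨v, hv, hbv⟩
    have hw := h1 _ (hU hu hv)
    refine ⟨u ⊓ v, hU hu hv, le_antisymm ?_ (le_inf hw (one_le_oneLePart _))⟩
    calc u ⊓ v ⊓ (a * b)⁺ᵐ
        ≤ u ⊓ v ⊓ a⁺ᵐ * b⁺ᵐ := inf_le_inf_left _ (oneLePart_mul_le a b)
      _ ≤ (u ⊓ v ⊓ a⁺ᵐ) * (u ⊓ v ⊓ b⁺ᵐ) :=
          inf_mul_le_inf_mul_inf hw (one_le_oneLePart a) (one_le_oneLePart b)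
      _ ≤ (u ⊓ a⁺ᵐ) * (v ⊓ b⁺ᵐ) :=
          mul_le_mul' (inf_le_inf_right _ inf_le_left) (inf_le_inf_right _ inf_le_right)
      _ = 1 := by rw [hau, hbv, one_mul]

theorem isLowerSet_polarSubmonoid {U : Set L} (hU : InfClosed U) (hne : U.Nonempty)
    (h1 : ∀ u ∈ U, 1 ≤ u) : IsLowerSet (polarSubmonoid U hU hne h1 : Set L) := by
  rintro a b hba ⟨u, hu, hau⟩
  refine ⟨u, hu, le_antisymm ?_ (le_inf (h1 u hu) (one_le_oneLePart b))⟩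
  exact (inf_le_inf_left u (oneLePart_mono hba)).trans_eq hau

theorem mem_or_inv_mem_polarSubmonoid {U : Set L}
    (hU : Maximal (fun U => InfClosed U ∧ U ⊆ Set.Ioi 1) U) (hne : U.Nonempty) (a : L) :
    a ∈ polarSubmonoid U hU.prop.1 hne (fun _ hu => (hU.prop.2 hu).le) ∨
      a⁻¹ ∈ polarSubmonoid U hU.prop.1 hne (fun _ hu => (hU.prop.2 hu).le) := by
  refine or_iff_not_imp_left.2 fun ha => ?_
  have hmem : ∀ u ∈ U, a⁺ᵐ ⊓ u ∈ U := inf_mem_of_maximal_infClosed hU fun u hu =>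
    (le_inf (one_le_oneLePart a) (hU.prop.2 hu).le).lt_of_ne fun h =>
      ha ⟨u, hu, by rw [inf_comm, ← h]⟩
  obtain ⟨u, hu⟩ := hne
  refine ⟨a⁺ᵐ ⊓ u, hmem u hu, ?_⟩
  rw [oneLePart_inv, inf_right_comm, oneLePart_inf_leOnePart_eq_one]
  exact inf_eq_left.2 (hU.prop.2 hu).le

theorem exists_total_isLowerSet_submonoid_notMem {c : L} (hc : ¬ c ≤ 1) :
    ∃ Q : Submonoid L, HasMemOrInvMem Q ∧ IsLowerSet (Q : Set L) ∧ c ∉ Q := by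
  have hc1 : 1 < c⁺ᵐ := (one_le_oneLePart c).lt_of_ne' (mt oneLePart_eq_one.1 hc)
  obtain ⟨U, hcU, hU⟩ := exists_maximal_infClosed_subset (Set.mem_Ioi.2 hc1)
  refine ⟨polarSubmonoid U hU.prop.1 ⟨_, hcU⟩ fun _ hu => (hU.prop.2 hu).le,
    ⟨mem_or_inv_mem_polarSubmonoid hU ⟨_, hcU⟩⟩, isLowerSet_polarSubmonoid _ _ _, ?_⟩
  rintro ⟨u, hu, h⟩
  exact (hU.prop.2 (hU.prop.1 hu hcU)).ne' h

end LatticeOrderedGroup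

section OrderAutomorphisms

variable {α : Type*} [LinearOrder α]

instance : PartialOrder (α ≃o α) := PartialOrder.lift (fun f => (f : α → α)) DFunLike.coe_injective

/-- The pointwise maximum of two automorphisms of a chain. -/
def orderAutSup (f g : α ≃o α) : α ≃o α where
  toFun x := f x ⊔ g x
  invFun x := f.symm x ⊓ g.symm x
  left_inv x := by
    rcases le_total (f x) (g x) with h | h
    · simpa [h, g.symm_apply_apply] using f.le_symm_apply.2 h
    · simpa [h, f.symm_apply_apply] using g.le_symm_apply.2 h
  right_inv x := by
    rcases le_total (f.symm x) (g.symm x) with h | h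
    · simpa [h] using g.le_symm_apply.1 h
    · simpa [h] using f.le_symm_apply.1 h
  map_rel_iff' := StrictMono.le_iff_le fun _ _ h => max_lt_max (f.strictMono h) (g.strictMono h)

/-- The pointwise minimum of two automorphisms of a chain. -/
def orderAutInf (f g : α ≃o α) : α ≃o α :=
  (orderAutSup f.symm g.symm).symm

instance : Lattice (α ≃o α) where
  sup := orderAutSup
  le_sup_left _ _ _ := le_sup_left
  le_sup_right _ _ _ := le_sup_right
  sup_le _ _ _ hf hg x := sup_le (hf x) (hg x)
  inf := orderAutInf
  inf_le_left _ _ _ := inf_le_left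
  inf_le_right _ _ _ := inf_le_right
  le_inf _ _ _ hf hg x := le_inf (hf x) (hg x)

instance : MulLeftMono (α ≃o α) := ⟨fun f _ _ h x => f.monotone (h x)⟩

instance : MulRightMono (α ≃o α) := ⟨fun f _ _ h x => h (f x)⟩

theorem orderAut_sup'_apply {ι : Type*} {s : Finset ι} (hs : s.Nonempty) (f : ι → α ≃o α) (x : α) :
    s.sup' hs f x = s.sup' hs fun i => f i x :=
  Finset.apply_sup'_eq_sup'_comp hs (fun f : α ≃o α => f x) fun _ _ => rfl

/-- The right regular representation of a right-ordered group by automorphisms of its chain. -/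
def rightRegularOrderAut (G : Type*) [Group G] [LinearOrder G] [MulRightMono G] :
    G →* (G ≃o G) where
  toFun g := OrderIso.mulRight g⁻¹
  map_one' := by ext; simp
  map_mul' a b := by ext; simp [mul_assoc]

end OrderAutomorphisms

namespace GroupTerm

variable {k : ℕ} {G : Type*} [Group G]

theorem map_eval {H : Type*} [Group H] (φ : G →* H) (v : Fin k → G) (t : GroupTerm k) :
    φ (t.eval v) = t.eval (φ ∘ v) := by
  induction t with
  | var i => rfl
  | one => exact map_one φ
  | mul s t hs ht => simp only [eval, map_mul, hs, ht]
  | inv t ht => simp only [eval, map_inv, ht]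

theorem lift_toFree (v : Fin k → G) (t : GroupTerm k) : FreeGroup.lift v t.toFree = t.eval v := by
  rw [toFree, map_eval]
  congr 1
  ext i
  exact FreeGroup.lift_apply_of

end GroupTerm

section Validity

variable {k n : ℕ} [NeZero n] {t : Fin n → GroupTerm k}

theorem ValidInLGroups.exists_eval_le_one (h : ValidInLGroups.{u} t) {G : Type u} [Group G]
    [LinearOrder G] [MulRightMono G] (v : Fin k → G) : ∃ i, (t i).eval v ≤ 1 := by
  have hsup := h (G ≃o G) (rightRegularOrderAut G ∘ v) 1
  simp only [orderAut_sup'_apply, ← GroupTerm.map_eval] at hsup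
  obtain ⟨i, -, hi⟩ := (Finset.le_sup'_iff _).1 hsup
  have hi' : 1 ≤ 1 * ((t i).eval v)⁻¹ := hi
  exact ⟨i, by simpa using mul_le_mul_left hi' ((t i).eval v)⟩

theorem ValidInLGroups.not_extendsToRightOrder (h : ValidInLGroups.{u} t) :
    ¬ ExtendsToRightOrder (Set.range fun i => (t i).toFree) := by
  rintro ⟨le, hle, ht⟩
  let : LinearOrder (FreeGroup (Fin k)) := hle.linearOrder
  have : MulRightMono (ULift.{u} (FreeGroup (Fin k))) :=
    ⟨fun c a b hab => hle.mul_right a.down b.down c.down hab⟩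
  let up : FreeGroup (Fin k) →* ULift.{u} (FreeGroup (Fin k)) := MulEquiv.ulift.symm.toMonoidHom
  obtain ⟨i, hi⟩ := h.exists_eval_le_one (up ∘ FreeGroup.of)
  rw [← GroupTerm.map_eval] at hi
  have hpos := ht ⟨i, rfl⟩
  exact hpos.2 (hle.antisymm _ _ hi hpos.1)

theorem validInLGroups_of_not_extendsToRightOrder
    (h : ¬ ExtendsToRightOrder (Set.range fun i => (t i).toFree)) : ValidInLGroups.{u} t := by
  intro L _ _ _ _ v
  by_contra hsup
  obtain ⟨Q, _, hlower, hQ⟩ := exists_total_isLowerSet_submonoid_notMem (mt inv_le_one'.1 hsup)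
  obtain ⟨P, hP, -⟩ := extendsToRightOrder_iff_exists_cone.1
    (extendsToRightOrder_empty_of_isFreeGroup (G := FreeGroup (Fin k)))
  refine h (extendsToRightOrder_iff_exists_cone.2
    ⟨_, isRightOrderCone_lexSubsemigroup (Q := Q.comap (FreeGroup.lift v)) hP, ?_⟩)
  rintro _ ⟨i, rfl⟩
  refine mem_lexSubsemigroup_of_inv_notMem fun hi => hQ ?_
  rw [Submonoid.mem_comap, map_inv, GroupTerm.lift_toFree] at hi
  have hle := Finset.le_sup' (fun i => (t i).eval v) (Finset.mem_univ i)
  exact hlower (inv_le_inv_iff.2 hle) hi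

end Validity

theorem theoremt (k n : ℕ) [NeZero n] (t : Fin n → GroupTerm k) :
    List.TFAE
      [ValidInLGroups.{u} t,
       ¬ ExtendsToRightOrder (Set.range fun i => (t i).toFree),
       ∃ (m : ℕ) (s : Fin m → FreeGroup (Fin k)), (∀ j, s j ≠ 1) ∧
         ∀ δ : Fin m → ℤˣ,
           (1 : FreeGroup (Fin k)) ∈ Subsemigroup.closure
             ((Set.range fun i => (t i).toFree) ∪ Set.range fun j => s j ^ (δ j : ℤ))] := by
  tfae_have 1 → 2 := ValidInLGroups.not_extendsToRightOrder
  tfae_have 2 → 1 := validInLGroups_of_not_extendsToRightOrder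
  tfae_have 2 ↔ 3 := not_extendsToRightOrder_iff_forall_signs
  tfae_finish
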